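/- Let $n\ge 3$, let $N_n=\{(i,j): 1\le i,j\le n,\ i\ne j\}$, and let $\hat{\mathcal E}_n\subseteq\mathbb R^{N_n}$ be the cone of quasi-semimetrics on $n$ points, that is, the set of all $x=(x_{ij})_{(i,j)\in N_n}$ such that $x_{ij}\ge 0$ for all $i\neq j$ and $x_{ij}+x_{jk}\ge x_{ik}$ for all pairwise distinct $i,j,k$. Let $\mathrm{Symm}(\hat{\mathcal E}_n)$ be the group of all linear automorphisms $\varphi$ of $\mathbb R^{N_n}$ with $\varphi(\hat{\mathcal E}_n)=\hat{\mathcal E}_n$ that preserve the Euclidean distance, and let $\mathrm{Lin}_{\mathbb Z}(\hat{\mathcal E}_n)$ be the group of all linear automorphisms $\varphi$ of $\mathbb R^{N_n}$ with $\varphi(\hat{\mathcal E}_n)=\hat{\mathcal E}_n$ and $\varphi(\hat{\mathcal E}_n\cap\mathbb Z^{N_n})=\hat{\mathcal E}_n\cap\mathbb Z^{N_n}$. Let $\mathcal S_n$ be the group of linear automorphisms of $\mathbb R^{N_n}$ generated by the maps $P_\pi:(x_{ij})\mapsto(x_{\pi(i)\pi(j)})$, for $\pi$ a permutation of $\{1,\dots,n\}$,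 and the transpose map $\tau:(x_{ij})\mapsto(x_{ji})$. Then $$\mathrm{Symm}(\hat{\mathcal E}_n)=\mathrm{Lin}_{\mathbb Z}(\hat{\mathcal E}_n)=\mathcal S_n .$$ Moreover, the elements of $\mathcal S_n$ are exactly the maps $P_\pi$ and $P_\pi\circ\tau$, with $\pi$ a permutation of $\{1,\dots,n\}$. Thus the isometries of the cone, and likewise its linear automorphisms preserving its integer points, are exactly the coordinate permutations induced by index permutations, possibly composed with transposition. -/

import Mathlib

noncomputable section

namespace QuasiSemimetric

/-! ### Symmetry groups of a cone in a coordinate space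

The group of linear automorphisms `V ≃ₗ[ℝ] V` carries composition as multiplication. -/

/-- The linear symmetry group of `C ⊆ ℝ^ι`: linear automorphisms `φ` of the ambient space
with `φ(C) = C`. -/
def linGroup {ι : Type*} (C : Set (EuclideanSpace ℝ ι)) :
    Subgroup (EuclideanSpace ℝ ι ≃ₗ[ℝ] EuclideanSpace ℝ ι) where
  carrier := {φ | φ '' C = C}
  one_mem' := by
    change (fun x => x) '' C = C
    exact Set.image_id' C
  mul_mem' := by
    intro φ ψ hφ hψ
    change (fun x => φ (ψ x)) '' C = C
    rw [← Set.image_image, show ψ '' C = C from hψ, show φ '' C = C from hφ]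
  inv_mem' := by
    intro φ hφ
    change φ.symm '' C = C
    conv_lhs => rw [← show φ '' C = C from hφ]
    rw [Set.image_image]
    simp

/-- The points of `ℝ^ι` all of whose coordinates are integers. -/
def integerPoints (ι : Type*) : Set (EuclideanSpace ℝ ι) :=
  {x | ∀ i, ∃ m : ℤ, x i = (m : ℝ)}

/-- The symmetry group `Symm(C)`: the linear automorphisms of `C` that preserve the Euclidean
distance. -/
def symmGroup {ι : Type*} [Fintype ι] (C : Set (EuclideanSpace ℝ ι)) :
    Subgroup (EuclideanSpace ℝ ι ≃ₗ[ℝ] EuclideanSpace ℝ ι) where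
  carrier := {φ | φ ∈ linGroup C ∧ ∀ x y, dist (φ x) (φ y) = dist x y}
  one_mem' := ⟨one_mem _, fun _ _ => rfl⟩
  mul_mem' := by
    rintro φ ψ ⟨hφ, hφ'⟩ ⟨hψ, hψ'⟩
    exact ⟨mul_mem hφ hψ, fun x y => (hφ' (ψ x) (ψ y)).trans (hψ' x y)⟩
  inv_mem' := by
    rintro φ ⟨hφ, hφ'⟩
    refine ⟨inv_mem hφ, fun x y => ?_⟩
    change dist (φ.symm x) (φ.symm y) = dist x y
    rw [← hφ' (φ.symm x) (φ.symm y), φ.apply_symm_apply, φ.apply_symm_apply]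

/-- The integral symmetry group `LinZ(C)`: the linear automorphisms of `C` that leave the set
of integer points of `C` invariant. -/
def linZGroup {ι : Type*} (C : Set (EuclideanSpace ℝ ι)) :
    Subgroup (EuclideanSpace ℝ ι ≃ₗ[ℝ] EuclideanSpace ℝ ι) :=
  linGroup C ⊓ linGroup (C ∩ integerPoints ι)

/-! ### The cone of quasi-semimetrics -/

/-- The index set `{(i, j) : i ≠ j}` of the off-diagonal entries of an `n × n` matrix. -/
abbrev Arc (n : ℕ) : Type := {p : Fin n × Fin n // p.1 ≠ p.2}

/-- The coordinate space `ℝ^{(i, j) : i ≠ j}` with its Euclidean structure, that is, the space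
of real `n × n` matrices with the (null) diagonal left out. -/
abbrev ArcSpace (n : ℕ) : Type := EuclideanSpace ℝ (Arc n)

/-- The cone of quasi-semimetrics on `n` points: triangle inequalities for pairwise distinct
indices, and nonnegativity. -/
def qsmCone (n : ℕ) : Set (ArcSpace n) :=
  {x | (∀ (i j k : Fin n) (hij : i ≠ j) (hjk : j ≠ k) (hik : i ≠ k),
          x ⟨(i, k), hik⟩ ≤ x ⟨(i, j), hij⟩ + x ⟨(j, k), hjk⟩) ∧
        ∀ (i j : Fin n) (hij : i ≠ j), 0 ≤ x ⟨(i, j), hij⟩}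

/-- The map `x_{ij} ↦ x_{π(i) π(j)}` induced by a permutation `π` of the indices. -/
def permMap {n : ℕ} (π : Equiv.Perm (Fin n)) : ArcSpace n ≃ₗ[ℝ] ArcSpace n where
  toFun x := WithLp.toLp 2 fun p => x ⟨(π p.1.1, π p.1.2), π.injective.ne p.2⟩
  invFun x := WithLp.toLp 2 fun p => x ⟨(π.symm p.1.1, π.symm p.1.2), π.symm.injective.ne p.2⟩
  map_add' _ _ := rfl
  map_smul' _ _ := rfl
  left_inv x := by ext p; simp
  right_inv x := by ext p; simp

/-- The transpose map `x_{ij} ↦ x_{ji}`. -/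
def transposeMap (n : ℕ) : ArcSpace n ≃ₗ[ℝ] ArcSpace n where
  toFun x := WithLp.toLp 2 fun p => x ⟨(p.1.2, p.1.1), p.2.symm⟩
  invFun x := WithLp.toLp 2 fun p => x ⟨(p.1.2, p.1.1), p.2.symm⟩
  map_add' _ _ := rfl
  map_smul' _ _ := rfl
  left_inv _ := rfl
  right_inv _ := rfl

/-- The group of system automorphisms: the group generated by the maps induced by index
permutations and the transpose map. -/
def systemGroup (n : ℕ) : Subgroup (ArcSpace n ≃ₗ[ℝ] ArcSpace n) :=
  Subgroup.closure (Set.range (permMap (n := n)) ∪ {transposeMap n})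

end QuasiSemimetric

end

noncomputable section

namespace QuasiSemimetric

open Finset

/-! ### Facets of polyhedral cones under linear maps -/

/-! The functionals `x_{ij}` and `x_{ij} + x_{jk} - x_{ik}` define distinct facets, so an
automorphism of the cone permutes them up to positive scalars (`exists_pos_smul_of_facets`).

For an isometry, comparing norms (`1` for a coordinate, `√3` for a triangle) and evaluating at the
all-ones point shows that coordinates go to coordinates with scalar `1`. In particular integer
points are preserved, so `Symm ≤ LinZ`, and `LinZ ≤ systemGroup` remains.

For an integral automorphism all scalars are `1`. The sum of the facet functionals, a multiple of
the sum of entries, is then invariant, and the nonzero integer points of the cone with sum of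
entries at most `n - 1` are the row and column stars (`eq_row_or_col`). These `2n` points are
therefore permuted. Each facet functional is `1` on exactly one row star and one column star and `0`
on the other stars; this incidence pattern forces a single index permutation, up to transposition
(`eq_permMap_of_rowStar`). -/

/-- A linear automorphism of a cone cut out by linear functionals permutes these functionals up
to positive scalars, provided that each of them vanishes alone at some point of the cone. -/
theorem exists_pos_smul_of_facets {V I : Type*} [AddCommGroup V] [Module ℝ V] [Finite I]
    (F : I → V →ₗ[ℝ] ℝ) (p : I → V) (q : V) (hp : ∀ i, F i (p i) = 0)
    (hp' : ∀ i j, j ≠ i → 0 < F j (p i)) (hq : ∀ i, 0 < F i q) (ψ : V ≃ₗ[ℝ] V)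
    (hψ : ∀ x, (∀ i, 0 ≤ F i (ψ x)) ↔ ∀ i, 0 ≤ F i x) (i : I) :
    ∃ j, ∃ c : ℝ, 0 < c ∧ ∀ x, F j (ψ x) = c * F i x := by
  classical
  cases nonempty_fintype I
  have key : ∀ (J : Finset I) (a b : V), (∀ j ∈ J, 0 < F j a) →
      ∃ ε : ℝ, 0 < ε ∧ ∀ j ∈ J, 0 ≤ F j a + ε * F j b := by
    intro J a b
    induction J using Finset.cons_induction with
    | empty => exact fun _ => ⟨1, one_pos, by simp⟩
    | cons k J hk ih =>
      intro h
      obtain ⟨ε, hε, H⟩ := ih fun j hj => h j (mem_cons_of_mem hj)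
      have hk0 := h k (mem_cons_self k J)
      refine ⟨min ε (F k a / (|F k b| + 1)), lt_min hε (by positivity), ?_⟩
      have hmin : 0 < min ε (F k a / (|F k b| + 1)) := lt_min hε (by positivity)
      intro j hj
      rcases mem_cons.1 hj with rfl | hj
      · have h1 := min_le_right ε (F j a / (|F j b| + 1))
        rw [le_div_iff₀ (by positivity)] at h1
        nlinarith [neg_abs_le (F j b)]
      · have h1 := min_le_left ε (F k a / (|F k b| + 1))
        have h2 := H j hj
        have h3 := h j (mem_cons_of_mem hj)
        rcases le_or_gt 0 (F j b) with h4 | h4 <;> nlinarith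
  have hpi : ∀ j, 0 ≤ F j (p i) := fun j => by
    rcases eq_or_ne j i with rfl | hj
    · exact (hp j).ge
    · exact (hp' i j hj).le
  -- Otherwise `ψ (p i)` is interior, and a small move along `-ψ q` stays in the cone although `F i`
  -- becomes negative at its preimage.
  obtain ⟨j, hj⟩ : ∃ j, F j (ψ (p i)) ≤ 0 := by
    by_contra! H
    obtain ⟨ε, hε, hH⟩ := key univ (ψ (p i)) (ψ (-q)) fun j _ => H j
    have h1 := (hψ (p i + ε • -q)).1 (fun j => by simpa using hH j (mem_univ j)) i
    have := mul_pos hε (hq i)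
    simp [hp i] at h1
    linarith
  have hj0 : F j (ψ (p i)) = 0 := le_antisymm hj ((hψ _).2 hpi j)
  -- Near `p i` the hyperplane `F i = 0` lies in the cone, so `F j ∘ ψ` is nonnegative on it, hence
  -- zero by linearity.
  have hker : ∀ v, F i v = 0 → 0 ≤ F j (ψ v) := by
    intro v hv
    obtain ⟨ε, hε, H⟩ := key (univ.filter (· ≠ i)) (p i) v fun j hj =>
      hp' i j (mem_filter.1 hj).2
    have h1 := (hψ (p i + ε • v)).2 (fun k => by
      by_cases hk : k = i
      · subst hk; simp [hp k, hv]
      · simpa using H k (by simp [hk])) j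
    simp only [map_add, map_smul, smul_eq_mul, hj0, zero_add] at h1
    exact (mul_nonneg_iff_of_pos_left hε).1 h1
  have hker' : ∀ v, F i v = 0 → F j (ψ v) = 0 := fun v hv =>
    le_antisymm (by simpa using hker (-v) (by simp [hv])) (hker v hv)
  have hformula : ∀ x, F j (ψ x) = F j (ψ q) / F i q * F i x := by
    intro x
    have h1 := hker' (x - (F i x / F i q) • q) (by simp [(hq i).ne'])
    simp only [map_sub, map_smul, smul_eq_mul] at h1
    rw [sub_eq_zero.1 h1]; ring
  refine ⟨j, F j (ψ q) / F i q, ?_, hformula⟩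
  refine lt_of_le_of_ne (div_nonneg ((hψ q).2 (fun k => (hq k).le) j) (hq i).le) fun h0 => ?_
  have h1 := hformula (ψ.symm q)
  rw [← h0, zero_mul, ψ.apply_symm_apply] at h1
  exact (hq j).ne' h1

theorem mem_linGroup_iff {ι : Type*} {C : Set (EuclideanSpace ℝ ι)}
    {φ : EuclideanSpace ℝ ι ≃ₗ[ℝ] EuclideanSpace ℝ ι} :
    φ ∈ linGroup C ↔ ∀ x, φ x ∈ C ↔ x ∈ C := by
  change φ '' C = C ↔ _
  constructor
  · intro h x
    conv_lhs => rw [← h]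
    exact φ.injective.mem_set_image
  · intro h
    ext y
    obtain ⟨x, rfl⟩ := φ.surjective y
    rw [h, φ.injective.mem_set_image]

/-! ### The facets of the cone of quasi-semimetrics -/

variable {n : ℕ}

/-- The ordered triples of pairwise distinct indices. -/
abbrev Triple (n : ℕ) : Type :=
  {t : Fin n × Fin n × Fin n // t.1 ≠ t.2.1 ∧ t.2.1 ≠ t.2.2 ∧ t.1 ≠ t.2.2}

/-- The entry `x_{ab}`, with the convention that diagonal entries vanish. -/
def entry (a b : Fin n) : ArcSpace n →ₗ[ℝ] ℝ :=
  if h : a ≠ b then (EuclideanSpace.proj ⟨(a, b), h⟩ : ArcSpace n →L[ℝ] ℝ).toLinearMap else 0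

theorem entry_of_ne {a b : Fin n} (h : a ≠ b) (x : ArcSpace n) :
    entry a b x = x ⟨(a, b), h⟩ := by
  simp [entry, h]

@[simp]
theorem entry_self (a : Fin n) (x : ArcSpace n) : entry a a x = 0 := by
  simp [entry]

theorem apply_eq_entry (p : Arc n) (x : ArcSpace n) : x p = entry p.1.1 p.1.2 x :=
  (entry_of_ne p.2 x).symm

theorem ext_entry {x y : ArcSpace n} (h : ∀ a b, a ≠ b → entry a b x = entry a b y) : x = y := by
  ext p
  rw [apply_eq_entry, apply_eq_entry, h _ _ p.2]

/-- The triangle functional `x_{ij} + x_{jk} - x_{ik}`. -/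
def triangle (i j k : Fin n) : ArcSpace n →ₗ[ℝ] ℝ :=
  entry i j + entry j k - entry i k

theorem triangle_apply (i j k : Fin n) (x : ArcSpace n) :
    triangle i j k x = entry i j x + entry j k x - entry i k x := rfl

/-- The functionals defining the cone of quasi-semimetrics. -/
def facet : Arc n ⊕ Triple n → ArcSpace n →ₗ[ℝ] ℝ
  | .inl p => entry p.1.1 p.1.2
  | .inr t => triangle t.1.1 t.1.2.1 t.1.2.2

theorem mem_qsmCone_iff {x : ArcSpace n} : x ∈ qsmCone n ↔ ∀ i, 0 ≤ facet i x := by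
  constructor
  · rintro ⟨h1, h2⟩ (⟨⟨a, b⟩, hp⟩ | ⟨⟨a, b, c⟩, hab, hbc, hac⟩)
    · simpa [facet, entry_of_ne hp] using h2 a b hp
    · simpa [facet, triangle_apply, entry_of_ne hab, entry_of_ne hbc, entry_of_ne hac]
        using h1 a b c hab hbc hac
  · intro h
    refine ⟨fun i j k hij hjk hik => ?_, fun i j hij => ?_⟩
    · simpa [facet, triangle_apply, entry_of_ne hij, entry_of_ne hjk, entry_of_ne hik]
        using h (.inr ⟨(i, j, k), hij, hjk, hik⟩)
    · simpa [facet, entry_of_ne hij] using h (.inl ⟨(i, j), hij⟩)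

/-- The point of `ArcSpace n` whose entries are the off-diagonal entries of a matrix. -/
def ofMatrix (f : Fin n → Fin n → ℝ) : ArcSpace n :=
  WithLp.toLp 2 fun p => f p.1.1 p.1.2

theorem entry_ofMatrix (f : Fin n → Fin n → ℝ) (a b : Fin n) :
    entry a b (ofMatrix f) = if a = b then 0 else f a b := by
  split_ifs with h
  · subst h; simp
  · rw [entry_of_ne h]; rfl

/-- The all-ones matrix. -/
def ones (n : ℕ) : ArcSpace n := ofMatrix fun _ _ => 1

/-- The common value `1` lets this point read off the scalar by which an automorphism rescales a
facet. -/
theorem facet_ones (i : Arc n ⊕ Triple n) : facet i (ones n) = 1 := by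
  rcases i with ⟨⟨a, b⟩, hp⟩ | ⟨⟨a, b, c⟩, hab, hbc, hac⟩
  · simp_all [facet, ones, entry_ofMatrix]
  · simp_all [facet, ones, triangle_apply, entry_ofMatrix]

/-- A point of the cone at which the given facet functional is the only one to vanish. -/
def facetPoint : Arc n ⊕ Triple n → ArcSpace n
  | .inl p => ofMatrix fun a b =>
      -- With `p = (u, v)`, row `v` and column `u` are raised so that triangles with the zero entry
      -- `x_{uv}` as a leg stay strict.
      1 + (if a = p.1.2 then 1 else 0) + (if b = p.1.1 then 1 else 0) -
        (if a = p.1.1 ∧ b = p.1.2 then 1 else 0)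
  | .inr t => ofMatrix fun a b =>
      -- For any other triple the legs sum to at least `5/2`, more than the largest entry `2`.
      if a = t.1.1 ∧ b = t.1.2.1 ∨ a = t.1.2.1 ∧ b = t.1.2.2 then 1
      else if a = t.1.1 ∧ b = t.1.2.2 then 2 else 3 / 2

theorem facet_facetPoint_self (i : Arc n ⊕ Triple n) : facet i (facetPoint i) = 0 := by
  rcases i with ⟨⟨a, b⟩, hp⟩ | ⟨⟨a, b, c⟩, hab, hbc, hac⟩
  · simp only at hp
    simp [facet, facetPoint, entry_ofMatrix, hp, hp.symm]
  · simp only at hab hbc hac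
    simp [facet, facetPoint, triangle_apply, entry_ofMatrix, hab, hbc, hac, hab.symm, hbc.symm]
    norm_num

theorem facet_facetPoint_pos (i j : Arc n ⊕ Triple n) (hij : j ≠ i) :
    0 < facet j (facetPoint i) := by
  rcases i with ⟨⟨a, b⟩, hp⟩ | ⟨⟨a, b, c⟩, hab, hbc, hac⟩ <;>
  rcases j with ⟨⟨d, e⟩, hq⟩ | ⟨⟨d, e, f⟩, hde, hef, hdf⟩ <;>
  simp only [ne_eq, Sum.inl.injEq, Sum.inr.injEq, Subtype.mk.injEq, Prod.mk.injEq] at * <;>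
  simp only [facet, facetPoint, triangle_apply, entry_ofMatrix]
  · grind
  · grind
  · grind
  · grind

theorem facet_injective : Function.Injective (facet (n := n)) := by
  intro i j h
  by_contra hij
  have h1 := facet_facetPoint_pos i j (Ne.symm hij)
  rw [← h, facet_facetPoint_self] at h1
  exact h1.false

theorem exists_facet_comp {φ : ArcSpace n ≃ₗ[ℝ] ArcSpace n} (hφ : φ ∈ linGroup (qsmCone n))
    (i : Arc n ⊕ Triple n) :
    ∃ j, ∃ c : ℝ, 0 < c ∧ ∀ x, facet i (φ x) = c * facet j x := by
  obtain ⟨j, c, hc, h⟩ := exists_pos_smul_of_facets facet facetPoint (ones n)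
    facet_facetPoint_self facet_facetPoint_pos (fun i => by simp [facet_ones]) φ⁻¹
    (fun x => by
      rw [← mem_qsmCone_iff, ← mem_qsmCone_iff]
      exact mem_linGroup_iff.1 (inv_mem hφ) x) i
  refine ⟨j, c⁻¹, inv_pos.2 hc, fun x => ?_⟩
  have h1 := h (φ x)
  rw [show φ⁻¹ (φ x) = x from φ.symm_apply_apply x] at h1
  rw [h1, inv_mul_cancel_left₀ hc.ne']

/-! ### Isometries of the cone permute the coordinates -/

/-- If an isometry carries a multiple `c` of a facet functional to a coordinate functional, then
`c ^ 2 ≤ 1`, and `c ^ 2 ≤ 1 / 3` unless the facet is a coordinate facet. -/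
theorem sq_le_of_isometry {φ : ArcSpace n ≃ₗ[ℝ] ArcSpace n}
    (hφ : ∀ x y, dist (φ x) (φ y) = dist x y) {p : Arc n} {j : Arc n ⊕ Triple n} {c : ℝ}
    (h : ∀ x, entry p.1.1 p.1.2 (φ x) = c * facet j x) :
    (∃ q, j = .inl q ∧ c ^ 2 ≤ 1) ∨ c ^ 2 ≤ 1 / 3 := by
  have key : ∀ x, (c * facet j x) ^ 2 ≤ ‖x‖ ^ 2 := by
    intro x
    have h1 : ‖φ x‖ = ‖x‖ := by simpa using hφ x 0
    rw [← h, ← h1, ← apply_eq_entry, EuclideanSpace.real_norm_sq_eq]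
    exact single_le_sum (f := fun i => φ x i ^ 2) (fun i _ => sq_nonneg _) (mem_univ p)
  rcases j with q | ⟨⟨a, b, d⟩, hab, hbd, had⟩
  · refine Or.inl ⟨q, rfl, ?_⟩
    simpa [facet, ← apply_eq_entry] using key (EuclideanSpace.single q 1)
  · right
    simp only at hab hbd had
    -- The test vector is the coefficient vector of the triangle functional: value `3`, squared norm
    -- `3`, so `9 c² ≤ 3`.
    have h1 := key (EuclideanSpace.single ⟨(a, b), hab⟩ 1 + EuclideanSpace.single ⟨(b, d), hbd⟩ 1
      - EuclideanSpace.single ⟨(a, d), had⟩ 1)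
    have h2 : ‖(EuclideanSpace.single ⟨(a, b), hab⟩ 1 + EuclideanSpace.single ⟨(b, d), hbd⟩ 1
      - EuclideanSpace.single ⟨(a, d), had⟩ 1 : ArcSpace n)‖ ^ 2 = 3 := by
      rw [← real_inner_self_eq_norm_sq]
      simp only [inner_sub_left, inner_sub_right, inner_add_left, inner_add_right,
        EuclideanSpace.inner_single_left, PiLp.single_apply]
      simp [hab, hbd, hab.symm, hbd.symm]
      norm_num
    rw [h2] at h1
    simp [facet, triangle_apply, entry_of_ne, hab, hbd, had, hab.symm, hbd.symm] at h1
    nlinarith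

/-- The entries of `φ (ones n)` are the scalars `c p`. Norm preservation makes the `c p ^ 2 ≤ 1`
average to `1`, so each `c p` is `1`, which rules out triangles. -/
theorem exists_coord_of_mem_symmGroup {φ : ArcSpace n ≃ₗ[ℝ] ArcSpace n}
    (hφ : φ ∈ symmGroup (qsmCone n)) (p : Arc n) : ∃ q, ∀ x, φ x p = x q := by
  choose σ c hc h using fun p : Arc n => exists_facet_comp hφ.1 (.inl p)
  have hle := fun p => sq_le_of_isometry hφ.2 (h p)
  have hle1 : ∀ p, c p ^ 2 ≤ 1 := fun p => by
    rcases hle p with ⟨_, _, h1⟩ | h1 <;> linarith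
  have hsum : ∑ p, c p ^ 2 = ∑ _p : Arc n, (1 : ℝ) := by
    have h1 : ‖φ (ones n)‖ ^ 2 = ‖ones n‖ ^ 2 := by
      rw [show ‖φ (ones n)‖ = ‖ones n‖ by simpa using hφ.2 (ones n) 0]
    rw [EuclideanSpace.real_norm_sq_eq, EuclideanSpace.real_norm_sq_eq] at h1
    calc ∑ p, c p ^ 2 = ∑ p, φ (ones n) p ^ 2 := sum_congr rfl fun p _ => by
          rw [apply_eq_entry, show entry p.1.1 p.1.2 (φ (ones n)) = _ from h p _, facet_ones,
            mul_one]
      _ = ∑ p, ones n p ^ 2 := h1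
      _ = _ := sum_congr rfl fun p _ => by simp [ones, ofMatrix]
  have hone := (sum_eq_sum_iff_of_le fun p _ => hle1 p).1 hsum p (mem_univ p)
  have hc1 : c p = 1 := by nlinarith [hc p]
  rcases hle p with ⟨q, hq, -⟩ | h1
  · refine ⟨q, fun x => ?_⟩
    rw [apply_eq_entry, show entry p.1.1 p.1.2 (φ x) = _ from h p x, hq, hc1, one_mul,
      apply_eq_entry]
    rfl
  · norm_num [hone] at h1

theorem symmGroup_le_linZGroup : symmGroup (qsmCone n) ≤ linZGroup (qsmCone n) := by
  have key : ∀ φ ∈ symmGroup (qsmCone n), ∀ x ∈ integerPoints (Arc n),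
      φ x ∈ integerPoints (Arc n) := by
    intro φ hφ x hx p
    obtain ⟨q, hq⟩ := exists_coord_of_mem_symmGroup hφ p
    rw [hq]
    exact hx q
  intro φ hφ
  refine ⟨hφ.1, mem_linGroup_iff.2 fun x => ?_⟩
  rw [Set.mem_inter_iff, Set.mem_inter_iff, mem_linGroup_iff.1 hφ.1]
  refine and_congr_right fun _ => ⟨fun h => ?_, key φ hφ x⟩
  have h1 := key φ⁻¹ (inv_mem hφ) _ h
  rwa [show φ⁻¹ (φ x) = x from φ.symm_apply_apply x] at h1

theorem systemGroup_le_symmGroup : systemGroup n ≤ symmGroup (qsmCone n) := by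
  have hdist : ∀ (φ : ArcSpace n ≃ₗ[ℝ] ArcSpace n) (e : Arc n ≃ Arc n),
      (∀ x p, φ x p = x (e p)) → ∀ x y, dist (φ x) (φ y) = dist x y := by
    intro φ e h x y
    rw [EuclideanSpace.dist_eq, EuclideanSpace.dist_eq]
    simp only [h]
    rw [Equiv.sum_comp e fun p => dist (x p) (y p) ^ 2]
  rw [systemGroup, Subgroup.closure_le]
  rintro φ (⟨π, rfl⟩ | rfl)
  · refine ⟨mem_linGroup_iff.2 fun x => ?_, hdist _ ((Equiv.prodCongr π π).subtypeEquiv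
      fun p => by simp) fun x p => rfl⟩
    have key : ∀ (π : Equiv.Perm (Fin n)) (x : ArcSpace n), x ∈ qsmCone n →
        permMap π x ∈ qsmCone n := fun π x hx =>
      ⟨fun i j k hij hjk hik => hx.1 _ _ _ (π.injective.ne hij) (π.injective.ne hjk)
        (π.injective.ne hik), fun i j hij => hx.2 _ _ (π.injective.ne hij)⟩
    refine ⟨fun h => ?_, key π x⟩
    have h1 := key π.symm _ h
    rwa [show permMap π.symm (permMap π x) = x from (permMap π).symm_apply_apply x] at h1
  · refine ⟨mem_linGroup_iff.2 fun x => ?_, hdist _ ((Equiv.prodComm _ _).subtypeEquiv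
      fun p => by simp [eq_comm]) fun x p => rfl⟩
    have key : ∀ x : ArcSpace n, x ∈ qsmCone n → transposeMap n x ∈ qsmCone n := fun x hx =>
      ⟨fun i j k hij hjk hik => (hx.1 k j i hjk.symm hij.symm hik.symm).trans_eq (add_comm _ _),
        fun i j hij => hx.2 j i hij.symm⟩
    exact ⟨fun h => key _ h, key x⟩

/-! ### The integer points with the least sum of entries -/

/-- The point whose nonzero entries are the ones in row `j`, all equal to `1`. -/
def rowStar (j : Fin n) : ArcSpace n := ofMatrix fun a _ => if a = j then 1 else 0

/-- The point whose nonzero entries are the ones in column `k`, all equal to `1`. -/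
def colStar (k : Fin n) : ArcSpace n := ofMatrix fun _ b => if b = k then 1 else 0

theorem entry_rowStar {a b : Fin n} (h : a ≠ b) (j : Fin n) :
    entry a b (rowStar j) = if a = j then 1 else 0 := by
  simp [rowStar, entry_ofMatrix, h]

theorem entry_colStar {a b : Fin n} (h : a ≠ b) (k : Fin n) :
    entry a b (colStar k) = if b = k then 1 else 0 := by
  simp [colStar, entry_ofMatrix, h]

/-- The index `j` of the row star on which a facet functional takes the value `1`. -/
def rowIndex : Arc n ⊕ Triple n → Fin n
  | .inl p => p.1.1
  | .inr t => t.1.2.1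

/-- The index `k` of the column star on which a facet functional takes the value `1`. -/
def colIndex : Arc n ⊕ Triple n → Fin n
  | .inl p => p.1.2
  | .inr t => t.1.2.1

theorem facet_rowStar (i : Arc n ⊕ Triple n) (j : Fin n) :
    facet i (rowStar j) = if rowIndex i = j then 1 else 0 := by
  rcases i with ⟨⟨a, b⟩, hp⟩ | ⟨⟨a, b, c⟩, hab, hbc, hac⟩
  · exact entry_rowStar hp j
  · simp only at hab hbc hac
    change triangle a b c _ = if b = j then 1 else 0
    simp only [triangle_apply, entry_rowStar hab, entry_rowStar hbc, entry_rowStar hac]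
    ring

theorem facet_colStar (i : Arc n ⊕ Triple n) (k : Fin n) :
    facet i (colStar k) = if colIndex i = k then 1 else 0 := by
  rcases i with ⟨⟨a, b⟩, hp⟩ | ⟨⟨a, b, c⟩, hab, hbc, hac⟩
  · exact entry_colStar hp k
  · simp only at hab hbc hac
    change triangle a b c _ = if b = k then 1 else 0
    simp only [triangle_apply, entry_colStar hab, entry_colStar hbc, entry_colStar hac]
    ring

/-- An off-diagonal index pair belongs to a single facet, whereas `(j, j)` is shared by all
triangles with middle index `j`. This tells the two kinds of facet apart. -/
theorem eq_inl_of_rowIndex_ne_colIndex {i : Arc n ⊕ Triple n} (h : rowIndex i ≠ colIndex i) :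
    i = .inl ⟨(rowIndex i, colIndex i), h⟩ := by
  rcases i with p | t
  · rfl
  · exact absurd rfl h

theorem exists_ne_ne (hn : 3 ≤ n) (a b : Fin n) : ∃ c, c ≠ a ∧ c ≠ b := by
  have h : ({a, b} : Finset (Fin n)).card < (univ : Finset (Fin n)).card := by
    rw [card_univ, Fintype.card_fin]
    exact card_le_two.trans_lt hn
  obtain ⟨c, -, hc⟩ := exists_mem_notMem_of_card_lt_card h
  exact ⟨c, by simpa using hc⟩

theorem exists_triple (hn : 3 ≤ n) (j : Fin n) :
   ∃ a b, a ≠ j ∧ j ≠ b ∧ a ≠ b := by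
  obtain ⟨a, ha, -⟩ := exists_ne_ne hn j j
  obtain ⟨b, hb, hb'⟩ := exists_ne_ne hn j a
  exact ⟨a, b, ha, hb.symm, hb'.symm⟩

theorem exists_facet_index (hn : 3 ≤ n) (j k : Fin n) :
    ∃ i : Arc n ⊕ Triple n, rowIndex i = j ∧ colIndex i = k := by
  by_cases h : j = k
  · subst h
    obtain ⟨a, b, ha, hb, hab⟩ := exists_triple hn j
    exact ⟨.inr ⟨(a, j, b), ha, hb, hab⟩, rfl, rfl⟩
  · exact ⟨.inl ⟨(j, k), h⟩, rfl, rfl⟩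

theorem rowStar_injective (hn : 3 ≤ n) : Function.Injective (rowStar (n := n)) := by
  intro j j' h
  obtain ⟨i, hi, -⟩ := exists_facet_index hn j j
  have h1 := congrArg (facet i) h
  rw [facet_rowStar, facet_rowStar, if_pos hi, hi] at h1
  by_contra h2
  simp [h2] at h1

theorem colStar_injective (hn : 3 ≤ n) : Function.Injective (colStar (n := n)) := by
  intro k k' h
  obtain ⟨i, -, hi⟩ := exists_facet_index hn k k
  have h1 := congrArg (facet i) h
  rw [facet_colStar, facet_colStar, if_pos hi, hi] at h1
  by_contra h2
  simp [h2] at h1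

theorem rowStar_ne_colStar (hn : 3 ≤ n) (j k : Fin n) : rowStar j ≠ colStar k := by
  intro h
  obtain ⟨l, hl, hl'⟩ := exists_ne_ne hn k k
  obtain ⟨i, hi, hi'⟩ := exists_facet_index hn j l
  have h1 := congrArg (facet i) h
  rw [facet_rowStar, facet_colStar, if_pos hi, hi'] at h1
  simp [hl] at h1

/-! ### Integral quasi-semimetrics with small sum of entries -/

section Matrix

variable {X : Fin n → Fin n → ℤ}

/-- Summing `X j k ≤ X j i + X i k` over `i` bounds `n * X j k` by the sums of row `j` and column
`k`. With `D` the sum off this cross, `D + (n - 1) * X j k ≤ n - 1`. -/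
theorem eq_zero_off_cross (h0 : ∀ a b, 0 ≤ X a b) (htri : ∀ a b c, X a c ≤ X a b + X b c)
    (hsum : ∑ a, ∑ b, X a b ≤ n - 1) (hn : 3 ≤ n) {j k : Fin n} (hjk : 1 ≤ X j k) :
    X j k = 1 ∧ ∀ a b, a ≠ j → b ≠ k → X a b = 0 := by
  have hcross : (n : ℤ) * X j k ≤ ∑ i, X j i + ∑ i, X i k := by
    rw [← sum_add_distrib]
    calc (n : ℤ) * X j k = ∑ _i : Fin n, X j k := by simp
      _ ≤ _ := sum_le_sum fun i _ => htri j i k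
  set D := ∑ a ∈ univ.erase j, ∑ b ∈ univ.erase k, X a b with hD
  have hD0 : 0 ≤ D := sum_nonneg fun a _ => sum_nonneg fun b _ => h0 a b
  -- The entry `X j k` lies in both the row and the column.
  have htot : ∑ a, ∑ b, X a b + X j k = ∑ i, X j i + ∑ i, X i k + D := by
    rw [← add_sum_erase univ (fun a => ∑ b, X a b) (mem_univ j),
      ← add_sum_erase univ (fun a => X a k) (mem_univ j),
      sum_congr rfl fun a (_ : a ∈ univ.erase j) =>
        (add_sum_erase univ (fun b => X a b) (mem_univ k)).symm, sum_add_distrib]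
    ring
  have hn' : (3 : ℤ) ≤ n := by exact_mod_cast hn
  have h1 : X j k = 1 := by nlinarith
  rw [h1] at hcross htot
  have hD1 : D = 0 := by linarith
  refine ⟨h1, fun a b ha hb => ?_⟩
  rw [hD, sum_eq_zero_iff_of_nonneg fun a _ => sum_nonneg fun b _ => h0 a b] at hD1
  have h2 := hD1 a (mem_erase.2 ⟨ha, mem_univ a⟩)
  rw [sum_eq_zero_iff_of_nonneg fun b _ => h0 a b] at h2
  exact h2 b (mem_erase.2 ⟨hb, mem_univ b⟩)

/-- The cross through `(j, i)` gives `X b k = 0` for `b ≠ j`, so the triangle inequality passes `X j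
k ≥ 1` on to `X j b`. The crosses through the entries of row `j` then kill all other off-diagonal
entries. -/
theorem eq_row_of_two (h0 : ∀ a b, 0 ≤ X a b) (htri : ∀ a b c, X a c ≤ X a b + X b c)
    (hsum : ∑ a, ∑ b, X a b ≤ n - 1) (hn : 3 ≤ n) {j i k : Fin n} (hij : i ≠ j) (hik : i ≠ k)
    (hji : 1 ≤ X j i) (hjk : 1 ≤ X j k) :
    ∀ a b, a ≠ b → X a b = if a = j then 1 else 0 := by
  have cross := fun {j k} => eq_zero_off_cross (j := j) (k := k) h0 htri hsum hn
  have hrow : ∀ b, b ≠ j → 1 ≤ X j b := by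
    intro b hb
    by_cases hbk : b = k
    · rwa [hbk]
    · have h1 := (cross hji).2 b k hb hik.symm
      have h2 := htri j b k
      omega
  intro a b hab
  split_ifs with ha
  · subst ha
    exact (cross (hrow b hab.symm)).1
  · obtain ⟨c, hcj, hcb⟩ := exists_ne_ne hn j b
    exact (cross (hrow c hcj)).2 a b ha hcb.symm

/-- A nonzero integral quasi-semimetric whose entries have sum at most `n - 1` is supported on
a row or on a column, where it is constantly `1`. -/
theorem eq_row_or_col (h0 : ∀ a b, 0 ≤ X a b)
    (htri : ∀ a b c, X a c ≤ X a b + X b c)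
    (hsum : ∑ a, ∑ b, X a b ≤ n - 1) (hn : 3 ≤ n) {j k : Fin n} (hjk : 1 ≤ X j k) :
    (∀ a b, a ≠ b → X a b = if a = j then 1 else 0) ∨
      ∀ a b, a ≠ b → X a b = if b = k then 1 else 0 := by
  obtain ⟨i, hij, hik⟩ := exists_ne_ne hn j k
  -- One of `X j i` and `X i k` is positive; the second case is the transpose of the first.
  have h1 := htri j i k
  by_cases hji : 1 ≤ X j i
  · exact Or.inl (eq_row_of_two h0 htri hsum hn hij hik hji hjk)
  · right
    have h2 := eq_row_of_two (X := fun a b => X b a) (j := k) (i := i) (k := j)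
      (fun a b => h0 b a) (fun a b c => (htri c b a).trans_eq (add_comm _ _))
      (by rwa [sum_comm]) hn hik hij (by omega) hjk
    exact fun a b hab => h2 b a hab.symm

end Matrix

/-- The sum of all entries. -/
def total (x : ArcSpace n) : ℝ := ∑ a, ∑ b, entry a b x

theorem entry_nonneg {x : ArcSpace n} (hx : x ∈ qsmCone n) (a b : Fin n) : 0 ≤ entry a b x := by
  rcases eq_or_ne a b with rfl | h
  · simp
  · rw [entry_of_ne h]
    exact hx.2 a b h

theorem entry_le_add {x : ArcSpace n} (hx : x ∈ qsmCone n) (a b c : Fin n) :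
    entry a c x ≤ entry a b x + entry b c x := by
  rcases eq_or_ne a b with rfl | hab
  · simp
  rcases eq_or_ne b c with rfl | hbc
  · simp
  rcases eq_or_ne a c with rfl | hac
  · simpa using add_nonneg (entry_nonneg hx a b) (entry_nonneg hx b a)
  rw [entry_of_ne hab, entry_of_ne hbc, entry_of_ne hac]
  exact hx.1 a b c hab hbc hac

theorem exists_int_entry {x : ArcSpace n} (hx : x ∈ integerPoints (Arc n)) (a b : Fin n) :
    ∃ m : ℤ, entry a b x = m := by
  rcases eq_or_ne a b with rfl | h
  · exact ⟨0, by simp⟩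
  · rw [entry_of_ne h]
    exact hx _

theorem eq_rowStar_or_colStar (hn : 3 ≤ n) {x : ArcSpace n} (hx : x ∈ qsmCone n)
    (hxi : x ∈ integerPoints (Arc n)) (hx0 : x ≠ 0) (hsum : total x ≤ n - 1) :
    (∃ j, x = rowStar j) ∨ ∃ k, x = colStar k := by
  choose X hX using exists_int_entry hxi
  have h0 : ∀ a b, 0 ≤ X a b := fun a b => by
    have := entry_nonneg hx a b
    rw [hX] at this
    exact_mod_cast this
  obtain ⟨j, k, hjk⟩ : ∃ j k, 1 ≤ X j k := by
    by_contra! H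
    refine hx0 (ext_entry fun a b _ => ?_)
    rw [hX, le_antisymm (Int.lt_add_one_iff.1 (H a b)) (h0 a b)]
    simp
  have htri : ∀ a b c, X a c ≤ X a b + X b c := fun a b c => by
    have := entry_le_add hx a b c
    rw [hX, hX, hX] at this
    exact_mod_cast this
  have hsumX : ∑ a, ∑ b, X a b ≤ n - 1 := by
    simp only [total, hX] at hsum
    exact_mod_cast hsum
  rcases eq_row_or_col h0 htri hsumX hn hjk with h | h
  · refine Or.inl ⟨j, ext_entry fun a b hab => ?_⟩
    rw [entry_rowStar hab, hX, h a b hab]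
    split_ifs <;> simp
  · refine Or.inr ⟨k, ext_entry fun a b hab => ?_⟩
    rw [entry_colStar hab, hX, h a b hab]
    split_ifs <;> simp

theorem total_rowStar (j : Fin n) : total (rowStar j) = n - 1 := by
  have : ∀ a b, entry a b (rowStar j) =
      (if a = j then 1 else 0) - if a = j ∧ b = j then 1 else 0 := by
    intro a b
    rw [rowStar, entry_ofMatrix]
    grind
  simp [total, this, ite_and]

theorem total_colStar (k : Fin n) : total (colStar k) = n - 1 := by
  have : ∀ a b, entry a b (colStar k) =
      (if b = k then 1 else 0) - if a = k ∧ b = k then 1 else 0 := by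
    intro a b
    rw [colStar, entry_ofMatrix]
    grind
  simp [total, this, ite_and]

theorem sum_triangle (x : ArcSpace n) : ∑ i, ∑ j, ∑ k, triangle i j k x = n * total x := by
  have h1 : ∑ i, ∑ _j : Fin n, ∑ k, entry i k x = ∑ _j : Fin n, total x := by
    rw [sum_comm]; rfl
  simp only [triangle_apply, sum_sub_distrib, sum_add_distrib, h1]
  simp [total, mul_sum]

theorem sum_subtype_eq_sum_ite {ι : Type*} [Fintype ι] (p : ι → Prop) [DecidablePred p]
    (f : ι → ℝ) : ∑ t : {t // p t}, f t = ∑ t, if p t then f t else 0 := by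
  rw [← sum_filter, sum_subtype (p := p) (univ.filter p) (by simp)]

/-- Being symmetric in the facets, this sum makes `total` invariant under any automorphism that
permutes the facet functionals. -/
theorem sum_facet (x : ArcSpace n) : ∑ i, facet i x = (n - 1) * total x := by
  have harc : ∑ p : Arc n, entry p.1.1 p.1.2 x = total x := by
    rw [sum_subtype_eq_sum_ite (fun p : Fin n × Fin n => p.1 ≠ p.2) fun p => entry p.1 p.2 x,
      Fintype.sum_prod_type]
    refine sum_congr rfl fun a _ => sum_congr rfl fun b _ => ?_
    rcases eq_or_ne a b with rfl | h <;> simp [*]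
  have htri : ∑ t : Triple n, triangle t.1.1 t.1.2.1 t.1.2.2 x = (n - 2) * total x := by
    -- Among degenerate triples only `i = k` contributes, with `x_{ij} + x_{ji}`; those with `i = j`
    -- or `j = k` give `0`.
    have hdeg : ∑ i, ∑ j, ∑ k, (if i = k then triangle i j k x else 0) = 2 * total x := by
      simp only [sum_ite_eq, mem_univ, if_true, triangle_apply, entry_self, sub_zero,
        sum_add_distrib]
      rw [sum_comm (f := fun i j => entry j i x), two_mul]
      rfl
    rw [sum_subtype_eq_sum_ite (fun t : Fin n × Fin n × Fin n =>
        t.1 ≠ t.2.1 ∧ t.2.1 ≠ t.2.2 ∧ t.1 ≠ t.2.2) fun t => triangle t.1 t.2.1 t.2.2 x,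
      Fintype.sum_prod_type, sub_mul, ← sum_triangle, ← hdeg, ← sum_sub_distrib]
    refine sum_congr rfl fun i _ => ?_
    rw [Fintype.sum_prod_type, ← sum_sub_distrib]
    refine sum_congr rfl fun j _ => ?_
    rw [← sum_sub_distrib]
    refine sum_congr rfl fun k _ => ?_
    rcases eq_or_ne i j with rfl | hij
    · simp [triangle_apply]
    rcases eq_or_ne j k with rfl | hjk
    · simp [triangle_apply]
    rcases eq_or_ne i k with rfl | hik <;> simp [*]
  rw [Fintype.sum_sum_type]
  simp only [facet, harc, htri]
  ring

/-! ### Integral automorphisms of the cone -/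

theorem ones_mem : ones n ∈ qsmCone n ∩ integerPoints (Arc n) :=
  ⟨mem_qsmCone_iff.2 fun i => by simp [facet_ones], fun _ => ⟨1, by simp [ones, ofMatrix]⟩⟩

theorem rowStar_mem (j : Fin n) : rowStar j ∈ qsmCone n ∩ integerPoints (Arc n) := by
  refine ⟨mem_qsmCone_iff.2 fun i => ?_, fun p => ⟨if p.1.1 = j then 1 else 0, ?_⟩⟩
  · rw [facet_rowStar]
    split_ifs <;> simp
  · rw [apply_eq_entry, entry_rowStar p.2]
    split_ifs <;> simp

theorem colStar_mem (k : Fin n) : colStar k ∈ qsmCone n ∩ integerPoints (Arc n) := by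
  refine ⟨mem_qsmCone_iff.2 fun i => ?_, fun p => ⟨if p.1.2 = k then 1 else 0, ?_⟩⟩
  · rw [facet_colStar]
    split_ifs <;> simp
  · rw [apply_eq_entry, entry_colStar p.2]
    split_ifs <;> simp

theorem exists_int_facet {x : ArcSpace n} (hx : x ∈ integerPoints (Arc n))
    (i : Arc n ⊕ Triple n) : ∃ m : ℤ, facet i x = m := by
  rcases i with p | ⟨⟨a, b, c⟩, h⟩
  · exact exists_int_entry hx _ _
  · obtain ⟨m₁, h₁⟩ := exists_int_entry hx a b
    obtain ⟨m₂, h₂⟩ := exists_int_entry hx b c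
    obtain ⟨m₃, h₃⟩ := exists_int_entry hx a c
    exact ⟨m₁ + m₂ - m₃, by simp [facet, triangle_apply, h₁, h₂, h₃]⟩

variable {ψ : ArcSpace n ≃ₗ[ℝ] ArcSpace n}

/-- An integral automorphism of the cone permutes the facet functionals. -/
theorem exists_facet_eq (hψ : ψ ∈ linZGroup (qsmCone n)) (i : Arc n ⊕ Triple n) :
    ∃ j, ∀ x, facet i (ψ x) = facet j x := by
  obtain ⟨j, c, hc, h⟩ := exists_facet_comp hψ.1 i
  -- Evaluating at `ones n` under `ψ` and under `ψ⁻¹` shows that `c` and its inverse are both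
  -- integers.
  obtain ⟨m, hm⟩ := exists_int_facet
    ((mem_linGroup_iff.1 hψ.2 (ones n)).2 ones_mem).2 i
  obtain ⟨l, hl⟩ := exists_int_facet
    ((mem_linGroup_iff.1 (inv_mem hψ).2 (ones n)).2 ones_mem).2 j
  have h1 := h (ψ⁻¹ (ones n))
  rw [show ψ (ψ⁻¹ (ones n)) = ones n from ψ.apply_symm_apply _, facet_ones, hl] at h1
  rw [h, facet_ones, mul_one] at hm
  rw [hm] at h1 hc
  have h2 : (1 : ℤ) = m * l := by exact_mod_cast h1
  have h3 : 0 < m := by exact_mod_cast hc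
  have h4 : m = 1 := Int.eq_one_of_mul_eq_one_right h3.le h2.symm
  exact ⟨j, fun x => by rw [h, hm, h4]; simp⟩

theorem facet_comp_injective {σ : Arc n ⊕ Triple n → Arc n ⊕ Triple n}
    (hσ : ∀ i x, facet i (ψ x) = facet (σ i) x) : Function.Injective σ := by
  intro i j h
  refine facet_injective (LinearMap.ext fun y => ?_)
  obtain ⟨x, rfl⟩ := ψ.surjective y
  rw [hσ, hσ, h]

theorem total_comp (hn : 3 ≤ n) (hψ : ψ ∈ linZGroup (qsmCone n)) (x : ArcSpace n) :
    total (ψ x) = total x := by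
  choose σ hσ using exists_facet_eq hψ
  have hb : Function.Bijective σ := Finite.injective_iff_bijective.1 (facet_comp_injective hσ)
  have h1 : ∑ i, facet i (ψ x) = ∑ i, facet i x := by
    simp only [hσ]
    exact hb.sum_comp fun i => facet i x
  rw [sum_facet, sum_facet] at h1
  have h2 : (3 : ℝ) ≤ n := by exact_mod_cast hn
  exact mul_left_cancel₀ (by linarith) h1

theorem apply_star (hn : 3 ≤ n) (hψ : ψ ∈ linZGroup (qsmCone n)) {x : ArcSpace n}
    (hx : (∃ j, x = rowStar j) ∨ ∃ k, x = colStar k) :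
    (∃ j, ψ x = rowStar j) ∨ ∃ k, ψ x = colStar k := by
  have hn' : (3 : ℝ) ≤ n := by exact_mod_cast hn
  have h1 : x ∈ qsmCone n ∩ integerPoints (Arc n) ∧ total x = n - 1 := by
    rcases hx with ⟨j, rfl⟩ | ⟨k, rfl⟩
    · exact ⟨rowStar_mem j, total_rowStar j⟩
    · exact ⟨colStar_mem k, total_colStar k⟩
  have h2 := (mem_linGroup_iff.1 hψ.2 x).2 h1.1
  refine eq_rowStar_or_colStar hn h2.1 h2.2 (fun h0 => ?_) (by rw [total_comp hn hψ, h1.2])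
  have h3 := h1.2
  rw [← total_comp hn hψ, h0] at h3
  simp only [total, map_zero, sum_const_zero] at h3
  linarith

/-- Two distinct row stars are never `1` on a common facet functional, while a row star and a column
star always are. So one row star going to a row star forces all of them to, and column stars go to
column stars. Diagonal index pairs must go to diagonal ones, so rows and columns undergo the same
permutation. -/
theorem eq_permMap_of_rowStar (hn : 3 ≤ n) (hψ : ψ ∈ linZGroup (qsmCone n)) {j₀ m₀ : Fin n}
    (h₀ : ψ (rowStar j₀) = rowStar m₀) : ∃ π, ψ = permMap π := by
  choose σ hσ using exists_facet_eq hψ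
  have hrow : ∀ j, ∃ m, ψ (rowStar j) = rowStar m := by
    intro j
    rcases apply_star hn hψ (.inl ⟨j, rfl⟩) with h | ⟨k, hk⟩
    · exact h
    -- A facet `i` equal to `1` on both images pulls back to one equal to `1` on both row stars,
    -- hence `j = j₀`.
    · obtain ⟨i, hi, hi'⟩ := exists_facet_index hn m₀ k
      have h1 := hσ i (rowStar j₀)
      have h2 := hσ i (rowStar j)
      rw [h₀, facet_rowStar, facet_rowStar, if_pos hi] at h1
      rw [hk, facet_colStar, facet_rowStar, if_pos hi'] at h2
      have h3 : rowIndex (σ i) = j₀ := by by_contra h; simp [h] at h1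
      have h4 : rowIndex (σ i) = j := by by_contra h; simp [h] at h2
      exact ⟨m₀, by rw [← h4, h3, h₀]⟩
  have hrow' : ∀ i, ψ (rowStar (rowIndex (σ i))) = rowStar (rowIndex i) := by
    intro i
    obtain ⟨m, hm⟩ := hrow (rowIndex (σ i))
    have h1 := hσ i (rowStar (rowIndex (σ i)))
    rw [hm, facet_rowStar, facet_rowStar, if_pos rfl] at h1
    have h2 : rowIndex i = m := by by_contra h; simp [h] at h1
    rw [hm, h2]
  have hcol' : ∀ i, ψ (colStar (colIndex (σ i))) = colStar (colIndex i) := by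
    intro i
    have h1 := hσ i (colStar (colIndex (σ i)))
    rw [facet_colStar, if_pos rfl] at h1
    rcases apply_star hn hψ (.inr ⟨colIndex (σ i), rfl⟩) with ⟨m, hm⟩ | ⟨m, hm⟩
    · rw [hm, facet_rowStar] at h1
      have h2 : rowIndex i = m := by by_contra h; simp [h] at h1
      rw [← h2, ← hrow'] at hm
      exact absurd (ψ.injective hm).symm (rowStar_ne_colStar hn _ _)
    · rw [hm, facet_colStar] at h1
      have h2 : colIndex i = m := by by_contra h; simp [h] at h1
      rw [hm, h2]
  have hrowinj : ∀ i i', rowIndex i = rowIndex i' → rowIndex (σ i) = rowIndex (σ i') :=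
    fun i i' h => rowStar_injective hn (ψ.injective (by rw [hrow', hrow', h]))
  have hcolinj : ∀ i i', colIndex i = colIndex i' → colIndex (σ i) = colIndex (σ i') :=
    fun i i' h => colStar_injective hn (ψ.injective (by rw [hcol', hcol', h]))
  have hdiag : ∀ j, ∃ a, ψ (rowStar a) = rowStar j ∧ ψ (colStar a) = colStar j := by
    intro j
    obtain ⟨a, b, ha, hb, hab⟩ := exists_triple hn j
    -- Two distinct facets with index pair `(j, j)`: an off-diagonal image pair would belong to only
    -- one facet, against injectivity of `σ`.
    let t : Arc n ⊕ Triple n := .inr ⟨(a, j, b), ha, hb, hab⟩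
    let t' : Arc n ⊕ Triple n := .inr ⟨(b, j, a), hb.symm, ha.symm, hab.symm⟩
    by_cases h : rowIndex (σ t) = colIndex (σ t)
    · exact ⟨_, hrow' t, by rw [h]; exact hcol' t⟩
    · exfalso
      have hr := hrowinj t t' rfl
      have hc := hcolinj t t' rfl
      have h1 : σ t = σ t' := by
        rw [eq_inl_of_rowIndex_ne_colIndex h,
          eq_inl_of_rowIndex_ne_colIndex (i := σ t') (by rwa [← hr, ← hc])]
        simp only [hr, hc]
      have h2 := facet_comp_injective hσ h1
      simp [t, t', hab] at h2
  choose θ hθr hθc using hdiag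
  have hθ : Function.Injective θ := fun j j' h =>
    rowStar_injective hn (by rw [← hθr j, ← hθr j', h])
  refine ⟨Equiv.ofBijective θ (Finite.injective_iff_bijective.1 hθ), LinearEquiv.ext fun x => ?_⟩
  ext p
  have hr : rowIndex (σ (.inl p)) = θ p.1.1 :=
    rowStar_injective hn (ψ.injective ((hrow' (.inl p)).trans (hθr _).symm))
  have hc : colIndex (σ (.inl p)) = θ p.1.2 :=
    colStar_injective hn (ψ.injective ((hcol' (.inl p)).trans (hθc _).symm))
  have h1 := hσ (.inl p) x
  rw [eq_inl_of_rowIndex_ne_colIndex (i := σ (.inl p)) (by rw [hr, hc]; exact hθ.ne p.2)] at h1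
  simp only [facet, hr, hc] at h1
  rw [apply_eq_entry, h1, entry_of_ne (hθ.ne p.2)]
  rfl

theorem transposeMap_mem : transposeMap n ∈ systemGroup n :=
  Subgroup.subset_closure (Or.inr rfl)

theorem permMap_mem (π : Equiv.Perm (Fin n)) : permMap π ∈ systemGroup n :=
  Subgroup.subset_closure (Or.inl ⟨π, rfl⟩)

theorem transposeMap_colStar (k : Fin n) : transposeMap n (colStar k) = rowStar k := rfl

theorem eq_permMap_or (hn : 3 ≤ n) (hψ : ψ ∈ linZGroup (qsmCone n)) :
    ∃ π, ψ = permMap π ∨ ψ = permMap π * transposeMap n := by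
  have j₀ : Fin n := ⟨0, by omega⟩
  rcases apply_star hn hψ (.inl ⟨j₀, rfl⟩) with ⟨m, hm⟩ | ⟨m, hm⟩
  · obtain ⟨π, h⟩ := eq_permMap_of_rowStar hn hψ hm
    exact ⟨π, Or.inl h⟩
  -- Composing with the transpose reduces to the case of a row star sent to a row star.
  · have hτ := symmGroup_le_linZGroup (systemGroup_le_symmGroup (transposeMap_mem (n := n)))
    obtain ⟨π, h⟩ := eq_permMap_of_rowStar hn (mul_mem hτ hψ) (j₀ := j₀) (m₀ := m)
      ((congrArg (transposeMap n) hm).trans (transposeMap_colStar m))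
    refine ⟨π, Or.inr (LinearEquiv.ext fun x => ?_)⟩
    have h1 := congrArg (transposeMap n) (LinearEquiv.congr_fun h x)
    exact h1

theorem mem_systemGroup_iff (hn : 3 ≤ n) (φ : ArcSpace n ≃ₗ[ℝ] ArcSpace n) :
    φ ∈ systemGroup n ↔ ∃ π, φ = permMap π ∨ φ = permMap π * transposeMap n := by
  refine ⟨fun h => eq_permMap_or hn (symmGroup_le_linZGroup (systemGroup_le_symmGroup h)), ?_⟩
  rintro ⟨π, rfl | rfl⟩
  · exact permMap_mem π
  · exact mul_mem (permMap_mem π) transposeMap_mem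

theorem linZGroup_le_systemGroup (hn : 3 ≤ n) : linZGroup (qsmCone n) ≤ systemGroup n :=
  fun φ hφ => (mem_systemGroup_iff hn φ).2 (eq_permMap_or hn hφ)

end QuasiSemimetric

end

theorem mainTheorem2 (n : ℕ) (hn : 3 ≤ n) :
    QuasiSemimetric.symmGroup (QuasiSemimetric.qsmCone n) = QuasiSemimetric.systemGroup n ∧
    QuasiSemimetric.linZGroup (QuasiSemimetric.qsmCone n) = QuasiSemimetric.systemGroup n ∧
    ∀ φ : QuasiSemimetric.ArcSpace n ≃ₗ[ℝ] QuasiSemimetric.ArcSpace n,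
      φ ∈ QuasiSemimetric.systemGroup n ↔
        ∃ π : Equiv.Perm (Fin n),
          φ = QuasiSemimetric.permMap π ∨
          φ = QuasiSemimetric.permMap π * QuasiSemimetric.transposeMap n :=
  ⟨le_antisymm (QuasiSemimetric.symmGroup_le_linZGroup.trans
      (QuasiSemimetric.linZGroup_le_systemGroup hn)) QuasiSemimetric.systemGroup_le_symmGroup,
    le_antisymm (QuasiSemimetric.linZGroup_le_systemGroup hn)
      (QuasiSemimetric.systemGroup_le_symmGroup.trans QuasiSemimetric.symmGroup_le_linZGroup),
    QuasiSemimetric.mem_systemGroup_iff hn⟩
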